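/- **Theorem 2.1 (Prediction Law).** Let $W=(W_t)_{t\ge 0}$ and $\tilde W=(\tilde W_t)_{t\ge 0}$ be independent Brownian motions on a probability space $(\Omega,\mathcal F,\mathbb P)$. Let $k\colon\mathbb R^2\to\mathbb R$ be a Volterra kernel, that is, $k(t,s)=0$ whenever $0\le t<s$, and $\int_0^t k(t,s)^2\,ds<\infty$ for all $t\ge 0$. Let $$X_t=\int_0^t k(t,s)\,dW_s,\qquad t\ge 0,$$ be the corresponding Gaussian Volterra process (a Wiener integral for each $t$). Let $a,b\in\mathbb R$ with $a^2+b^2>0$, let $W^{a,b}=aW+b\tilde W$ be the noisy observation, and let $\mathcal F^{a,b}_u=\sigma(W^{a,b}_v: v\le u)$. Then for every $u>0$ the regular conditional law of $X=(X_t)_{t\in[0,\infty)}$ given $\mathcal F^{a,b}_u$ is Gaussian, with random mean $$\hat m^{a,b}_t(u)=\frac{a}{a^2+b^2}\int_0^u k(t,s)\,dW^{a,b}_s$$ and deterministic covariance $$\hat r^{a,b}(t,s|u)=\int_0^{t\wedge s}\Bigl(1-\frac{a^2}{a^2+b^2}\mathbf 1_{[0,u)}(v)\Bigr)^2k(t,v)k(s,v)\,dv+\frac{a^2b^2}{(a^2+b^2)^2}\int_0^u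 k(t,v)k(s,v)\,dv .$$ Here the law is taken on $\mathbb R^{[0,\infty)}$ with the product $\sigma$-algebra, and the claim means the following. 1. The Wiener integrals $\int_0^u k(t,s)\,dW^{a,b}_s$, $t\ge0$, exist and have $\mathcal F^{a,b}_u$-measurable versions. For every choice of such versions there is a regular conditional law of $X$ given $\mathcal F^{a,b}_u$ which, for every $\omega\in\Omega$, is the Gaussian law with mean function $t\mapsto\hat m^{a,b}_t(u)(\omega)$ and covariance function $\hat r^{a,b}(\cdot,\cdot|u)$. 2. For every regular conditional law of $X$ given $\mathcal F^{a,b}_u$, every choice of versions of these Wiener integrals, and every countable set $S\subset[0,\infty)$, almost surely the image of the conditional law under restriction to the times in $S$ is the Gaussian law with this mean and covariance restricted to $S$. -/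

import Mathlib

open MeasureTheory ProbabilityTheory Filter Topology
open scoped NNReal ENNReal

noncomputable section

/-- A step function on `[0,∞)`: the finite linear combination
`∑ i, coeff i * 1_{(left i, right i]}` of indicators of bounded intervals. -/
structure StepFun where
  n : ℕ
  coeff : Fin n → ℝ
  left : Fin n → ℝ≥0
  right : Fin n → ℝ≥0
  left_le_right : ∀ i, left i ≤ right i

/-- The value of a step function at the time `v`. -/
def StepFun.eval (φ : StepFun) (v : ℝ) : ℝ :=
  ∑ i, φ.coeff i * (Set.Ioc (φ.left i : ℝ) (φ.right i : ℝ)).indicator 1 v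

/-- The elementary integral `∑ i, coeff i * (B_{right i} - B_{left i})` of a step function. -/
def StepFun.integral {Ω : Type*} (φ : StepFun) (B : ℝ≥0 → Ω → ℝ) (ω : Ω) : ℝ :=
  ∑ i, φ.coeff i * (B (φ.right i) ω - B (φ.left i) ω)

/-- `Y` is (a version of) the Wiener integral `∫_0^u f(s) dB_s`: it is the `L²(P)`-limit of the
elementary integrals of step functions supported in `(0,u]` that converge to `f` in `L²([0,u])`.
If `B` is a multiple of a Brownian motion, this determines `Y` up to a `P`-null set. -/
def IsWienerIntegral {Ω : Type*} [MeasurableSpace Ω] (P : Measure Ω) (B : ℝ≥0 → Ω → ℝ)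
    (f : ℝ → ℝ) (u : ℝ≥0) (Y : Ω → ℝ) : Prop :=
  AEStronglyMeasurable Y P ∧
  ∃ φ : ℕ → StepFun,
    (∀ n i, (φ n).right i ≤ u) ∧
    Tendsto (fun n ↦ eLpNorm (fun v ↦ (φ n).eval v - f v) 2
      (volume.restrict (Set.Ioc (0 : ℝ) u))) atTop (𝓝 0) ∧
    Tendsto (fun n ↦ eLpNorm (fun ω ↦ (φ n).integral B ω - Y ω) 2 P) atTop (𝓝 0)

/-- The mixed process `W^{a,b} = a W + b W'`. -/
def mixedProcess {Ω : Type*} (a b : ℝ) (W W' : ℝ≥0 → Ω → ℝ) (t : ℝ≥0) (ω : Ω) : ℝ :=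
  a * W t ω + b * W' t ω

/-- The σ-algebra `σ(B_v : v ≤ u)` generated by a process up to the time `u`. -/
abbrev pastSigma {Ω : Type*} (B : ℝ≥0 → Ω → ℝ) (u : ℝ≥0) : MeasurableSpace Ω :=
  ⨆ v : ℝ≥0, ⨆ _ : v ≤ u, MeasurableSpace.comap (B v) inferInstance

/-- `κ` is a regular conditional law under `P` of the random element `X` given the σ-algebra `m`:
it is a Markov kernel from `(Ω, m)` and, for every measurable `A`, the function `ω ↦ κ ω A` is a
version of the conditional probability `P(X ∈ A | m)`. -/
structure IsRegularCondLaw {Ω E : Type*} [mΩ : MeasurableSpace Ω] [MeasurableSpace E]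
    (P : Measure Ω) (m : MeasurableSpace Ω) (X : Ω → E) (κ : @Kernel Ω E m _) : Prop where
  isMarkov : @IsMarkovKernel Ω E m _ κ
  condProb : ∀ A : Set E, MeasurableSet A →
    (fun ω ↦ (κ ω).real A) =ᵐ[P] P[(X ⁻¹' A).indicator (fun _ ↦ (1 : ℝ)) | m]

/-- The law `ν` on the space of functions `T → ℝ` is Gaussian (all finite-dimensional
distributions are Gaussian, possibly degenerate) with mean function `μ` and covariance
function `r`. -/
structure IsGaussianLawWith {T : Type*} (ν : Measure (T → ℝ)) (μ : T → ℝ) (r : T → T → ℝ) :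
    Prop where
  gaussian : IsGaussianProcess (fun (t : T) (x : T → ℝ) ↦ x t) ν
  mean : ∀ t, ∫ x, x t ∂ν = μ t
  covariance : ∀ t s, cov[fun x ↦ x t, fun x ↦ x s; ν] = r t s

/-- The prediction covariance
`∫_0^{t∧s} (1 - a²/(a²+b²) 1_{[0,u)}(v))² k(t,v) k(s,v) dv
  + a²b²/(a²+b²)² ∫_0^u k(t,v) k(s,v) dv`. -/
def predictionCov (k : ℝ → ℝ → ℝ) (a b : ℝ) (u t s : ℝ≥0) : ℝ :=
  (∫ v in (0 : ℝ)..(min t s : ℝ≥0),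
      (1 - a ^ 2 / (a ^ 2 + b ^ 2) * (Set.Ico (0 : ℝ) u).indicator 1 v) ^ 2 * k t v * k s v)
    + a ^ 2 * b ^ 2 / (a ^ 2 + b ^ 2) ^ 2 * ∫ v in (0 : ℝ)..u, k t v * k s v

end

/-!
Write `c = a² + b²`. The observed noise `W^{a,b} = a W + b W'` is uncorrelated with `b W - a W'`,
and `c W = a W^{a,b} + b (b W - a W')`. So the best prediction of `X_t = ∫_0^t k(t,s) dW_s` from
`W^{a,b}` on `[0,u]` is `a/c ∫_0^u k(t,s) dW^{a,b}_s`, and the residual, that is, `X_t` minus this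
prediction, is uncorrelated with the observation. All these variables lie in one Gaussian Hilbert
space, so the residual process is independent of the observed σ-algebra. The conditional law of `X`
is therefore the law of the residual, translated by the prediction; its covariance is the
covariance of the residual.

Gaussian Hilbert space: a subspace of `L²(P)` in which every element `Y` has law `N(0, ‖Y‖²)`.
The span of a centred Gaussian process is one, and the property passes to the closure because both
sides of `E exp(isY) = exp(-s²‖Y‖²/2)` are continuous on `L²(P)`
(`IsCenteredGaussianSpace.topologicalClosure`).

Wiener integrals are handled through the closed subspace `IsBrownianPair.graph` of triples
`(f, g, ∫ f dW + ∫ g dW')`, which is generated by `(1_{(0,t]}, 0, W_t)` and `(0, 1_{(0,t]}, W'_t)`.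
The Wiener isometry (`IsBrownianPair.inner_eq`) is checked on the generators and extends to the
closure. A Wiener integral of `f` with respect to `W^{a,b}` corresponds to the triple with first
entries `a f` and `b f` (`IsBrownianPair.exists_mem_graph_of_isWienerIntegral`), so that every
covariance is read off from inner products in `L²(0,∞)`.

Uniqueness of the conditional law on countably many coordinates holds because two conditional laws
agree almost surely on a countable algebra generating the product σ-algebra
(`IsRegularCondLaw.ae_map_eq`).
-/

noncomputable section

/-! ### Gaussian Hilbert spaces -/

/-- A subspace of `L²(P)` all of whose elements are centred Gaussian random variables, with
variance the squared `L²`-norm. -/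
def IsCenteredGaussianSpace {Ω : Type*} [MeasurableSpace Ω] (P : Measure Ω)
    (H : Submodule ℝ (Lp ℝ 2 P)) : Prop :=
  ∀ Y ∈ H, P.map Y = gaussianReal 0 (‖Y‖₊ ^ 2)

section GaussianSpace

variable {Ω : Type*} [MeasurableSpace Ω] {P : Measure Ω}

lemma integral_abs_le_norm_Lp_two [IsProbabilityMeasure P] (Y : Lp ℝ 2 P) :
    ∫ ω, |Y ω| ∂P ≤ ‖Y‖ := by
  have h := eLpNorm_le_eLpNorm_of_exponent_le (μ := P) (f := Y) (p := 1) (q := 2)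
    (by norm_num) (Lp.aestronglyMeasurable Y)
  rw [Lp.norm_def]
  have h2 : ∫ ω, |Y ω| ∂P = (eLpNorm Y 1 P).toReal := by
    rw [eLpNorm_one_eq_lintegral_enorm, ← integral_norm_eq_lintegral_enorm
      (Lp.aestronglyMeasurable Y)]
    rfl
  rw [h2]
  exact ENNReal.toReal_mono (Lp.eLpNorm_ne_top Y) h

lemma charFun_map_Lp (Y : Lp ℝ 2 P) (s : ℝ) :
    charFun (P.map Y) s = ∫ ω, Complex.exp (Complex.I * (s * Y ω : ℝ)) ∂P := by
  rw [charFun_apply_real, integral_map (Lp.aestronglyMeasurable Y).aemeasurable (by fun_prop)]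
  simp [mul_comm]

lemma lipschitzWith_integral_exp [IsProbabilityMeasure P] (s : ℝ) :
    LipschitzWith ⟨|s|, abs_nonneg s⟩
      (fun Y : Lp ℝ 2 P ↦ ∫ ω, Complex.exp (Complex.I * (s * Y ω : ℝ)) ∂P) := by
  have hint (Y : Lp ℝ 2 P) :
      Integrable (fun ω ↦ Complex.exp (Complex.I * (s * Y ω : ℝ))) P := by
    refine Integrable.of_bound (C := 1) ?_ (ae_of_all _ fun ω ↦ ?_)
    · have := (Lp.aestronglyMeasurable Y).aemeasurable
      exact (by fun_prop : AEMeasurable _ P).aestronglyMeasurable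
    · rw [Complex.norm_exp_I_mul_ofReal]
  refine LipschitzWith.of_dist_le_mul fun Y Z ↦ ?_
  rw [dist_eq_norm, dist_eq_norm, ← integral_sub (hint Y) (hint Z)]
  calc _ ≤ ∫ ω, |s| * |(Y - Z : Lp ℝ 2 P) ω| ∂P := by
        refine norm_integral_le_of_norm_le
          (((Lp.memLp (Y - Z)).integrable (by norm_num)).abs.const_mul _) ?_
        filter_upwards [Lp.coeFn_sub Y Z] with ω hω
        have h1 : Complex.exp (Complex.I * (s * Y ω : ℝ)) - Complex.exp (Complex.I * (s * Z ω : ℝ))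
            = Complex.exp (Complex.I * (s * Z ω : ℝ)) *
              (Complex.exp (Complex.I * (s * (Y ω - Z ω) : ℝ)) - 1) := by
          rw [mul_sub, ← Complex.exp_add, mul_one]
          congr 2
          push_cast
          ring
        rw [h1, norm_mul, Complex.norm_exp_I_mul_ofReal, one_mul, hω, ← abs_mul]
        exact Real.norm_exp_I_mul_ofReal_sub_one_le
    _ ≤ |s| * ‖Y - Z‖ := by
        rw [integral_const_mul]
        exact mul_le_mul_of_nonneg_left (integral_abs_le_norm_Lp_two _) (abs_nonneg s)

/-- For a random variable `Y` in `L²`, both sides of the identity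
`E exp(i s Y) = exp(-s² ‖Y‖² / 2)` are continuous in `Y`, so that being centred Gaussian is a
closed condition. -/
lemma IsCenteredGaussianSpace.topologicalClosure [IsProbabilityMeasure P]
    {H : Submodule ℝ (Lp ℝ 2 P)}
    (hH : IsCenteredGaussianSpace P H) : IsCenteredGaussianSpace P H.topologicalClosure := by
  have key (Y : Lp ℝ 2 P) : P.map Y = gaussianReal 0 (‖Y‖₊ ^ 2) ↔
      ∀ s : ℝ, ∫ ω, Complex.exp (Complex.I * (s * Y ω : ℝ)) ∂P =
        Complex.exp (-(‖Y‖ ^ 2 * s ^ 2 / 2 : ℝ)) := by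
    have := Measure.isProbabilityMeasure_map (μ := P) (Lp.aestronglyMeasurable Y).aemeasurable
    have h2 (s : ℝ) : charFun (gaussianReal 0 (‖Y‖₊ ^ 2)) s =
        Complex.exp (-(‖Y‖ ^ 2 * s ^ 2 / 2 : ℝ)) := by
      rw [charFun_gaussianReal]
      simp
    constructor
    · intro h s
      rw [← charFun_map_Lp, h, h2]
    · intro h
      refine Measure.ext_of_charFun (funext fun s ↦ ?_)
      rw [charFun_map_Lp, h, h2]
  intro Y hY
  have hcl : IsClosed {Y : Lp ℝ 2 P | P.map Y = gaussianReal 0 (‖Y‖₊ ^ 2)} := by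
    simp_rw [key, Set.ofPred_forall]
    refine isClosed_iInter fun s ↦ isClosed_eq (lipschitzWith_integral_exp s).continuous ?_
    fun_prop
  exact closure_minimal (fun Z hZ ↦ hH Z hZ) hcl hY

lemma norm_sq_eq_variance {Y : Lp ℝ 2 P} (h0 : ∫ ω, Y ω ∂P = 0) : Var[Y; P] = ‖Y‖ ^ 2 := by
  rw [variance_of_integral_eq_zero (Lp.aestronglyMeasurable Y).aemeasurable h0,
    ← real_inner_self_eq_norm_sq, L2.inner_def]
  simp [sq]

/-- The linear span of a centred Gaussian process consists of centred Gaussian variables. -/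
lemma isCenteredGaussianSpace_span [IsProbabilityMeasure P] {T : Type*} {Z : T → Ω → ℝ}
    (hZ : IsGaussianProcess Z P) (h0 : ∀ t, ∫ ω, Z t ω ∂P = 0) (hL : ∀ t, MemLp (Z t) 2 P) :
    IsCenteredGaussianSpace P (Submodule.span ℝ (Set.range fun t ↦ (hL t).toLp (Z t))) := by
  intro Y hY
  obtain ⟨c, rfl⟩ := Finsupp.mem_span_range_iff_exists_finsupp.1 hY
  set Y := c.sum fun t x ↦ x • (hL t).toLp (Z t) with hYdef
  have hYae : Y =ᵐ[P] fun ω ↦ ∑ t ∈ c.support, c t • Z t ω := by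
    rw [hYdef, Finsupp.sum]
    have h1 : ∀ᵐ ω ∂P, ∀ t ∈ c.support, (c t • (hL t).toLp (Z t) : Lp ℝ 2 P) ω = c t • Z t ω := by
      rw [Finset.eventually_all]
      intro t _
      filter_upwards [Lp.coeFn_smul (c t) ((hL t).toLp (Z t)), (hL t).coeFn_toLp] with ω h1 h2
      rw [h1, Pi.smul_apply, h2]
    filter_upwards [Lp.coeFn_finsetSum c.support (fun t ↦ c t • (hL t).toLp (Z t)), h1]
      with ω h2 h3
    rw [h2, Finset.sum_apply]
    exact Finset.sum_congr rfl h3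
  have hG : HasGaussianLaw Y P := ((hZ.smul c).hasGaussianLaw_fun_sum).congr hYae.symm
  have hm : ∫ ω, Y ω ∂P = 0 := by
    rw [integral_congr_ae hYae, integral_finsetSum _ fun t _ ↦
      (((hL t).integrable (by norm_num)).fun_smul (c t))]
    refine Finset.sum_eq_zero fun t _ ↦ ?_
    rw [integral_smul, h0, smul_zero]
  rw [hG.map_eq_gaussianReal, hm, norm_sq_eq_variance hm]
  congr 1
  ext
  simp

lemma IsCenteredGaussianSpace.integral_eq_zero {H : Submodule ℝ (Lp ℝ 2 P)}
    (hH : IsCenteredGaussianSpace P H) {Y : Lp ℝ 2 P} (hY : Y ∈ H) : ∫ ω, Y ω ∂P = 0 := by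
  have h := integral_map (μ := P) (Lp.aestronglyMeasurable Y).aemeasurable
    (f := fun x : ℝ ↦ x) (by fun_prop)
  rw [← h, hH Y hY, integral_id_gaussianReal]

/-- A process with values in a Gaussian Hilbert space is a Gaussian process. -/
lemma IsCenteredGaussianSpace.isGaussianProcess {H : Submodule ℝ (Lp ℝ 2 P)}
    (hH : IsCenteredGaussianSpace P H) {T : Type*} {Z : T → Lp ℝ 2 P} (hZ : ∀ t, Z t ∈ H) :
    IsGaussianProcess (fun t ω ↦ Z t ω) P where
  hasGaussianLaw I := by
    classical
    have hm : AEMeasurable (fun ω ↦ I.restrict (fun t ↦ Z t ω)) P :=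
      aemeasurable_pi_lambda _ fun t ↦ (Lp.aestronglyMeasurable (Z t)).aemeasurable
    refine ⟨isGaussian_of_map_eq_gaussianReal fun L ↦ ?_⟩
    set Y : Lp ℝ 2 P := ∑ i : I, L (Pi.single i 1) • Z i with hYdef
    have hYH : Y ∈ H := Submodule.sum_mem _ fun i _ ↦ H.smul_mem _ (hZ i)
    refine ⟨0, ‖Y‖₊ ^ 2, ?_⟩
    rw [← hH Y hYH, AEMeasurable.map_map_of_aemeasurable (by fun_prop) hm]
    refine Measure.map_congr ?_
    have h1 : ∀ᵐ ω ∂P, ∀ i : I, (L (Pi.single i 1) • Z i : Lp ℝ 2 P) ω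
        = L (Pi.single i 1) * Z i ω := by
      rw [ae_all_iff]
      intro i
      filter_upwards [Lp.coeFn_smul (L (Pi.single i 1)) (Z i)] with ω h1
      rw [h1, Pi.smul_apply, smul_eq_mul]
    filter_upwards [Lp.coeFn_finsetSum Finset.univ (fun i : I ↦ L (Pi.single i 1) • Z i), h1]
      with ω h2 h3
    rw [hYdef, h2, Finset.sum_apply]
    simp only [h3, Function.comp_apply]
    conv_lhs => rw [← Finset.univ_sum_single (I.restrict fun t ↦ Z t ω), map_sum]
    refine Finset.sum_congr rfl fun i _ ↦ ?_
    have : (Pi.single i (I.restrict (fun t ↦ Z t ω) i) : I → ℝ)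
        = Z i ω • Pi.single i (1 : ℝ) := by
      rw [← Pi.single_smul]
      simp
    rw [this, map_smul, smul_eq_mul, mul_comm]

end GaussianSpace

/-! ### The Wiener isometry of a pair of independent Brownian motions -/

/-- Lebesgue measure on the time axis `(0,∞)`. -/
abbrev timeMeasure : Measure ℝ := volume.restrict (Set.Ioi 0)

lemma timeMeasure_restrict_Ioc (u : ℝ≥0) :
    timeMeasure.restrict (Set.Ioc (0 : ℝ) u) = volume.restrict (Set.Ioc (0 : ℝ) u) := by
  rw [timeMeasure, Measure.restrict_restrict measurableSet_Ioc,
    Set.inter_eq_left.2 Set.Ioc_subset_Ioi_self]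

lemma timeMeasure_Ioc_ne_top (l r : ℝ) : timeMeasure (Set.Ioc l r) ≠ ∞ :=
  ((Measure.restrict_apply_le _ _).trans_lt measure_Ioc_lt_top).ne

/-- The indicator of `(0,t]` as an element of `L²(0,∞)`. -/
def initialLp (t : ℝ≥0) : Lp ℝ 2 timeMeasure :=
  indicatorConstLp 2 (measurableSet_Ioc (a := (0 : ℝ)) (b := t)) (timeMeasure_Ioc_ne_top 0 t) 1

lemma inner_initialLp (s t : ℝ≥0) : inner ℝ (initialLp s) (initialLp t) = min s t := by
  rw [initialLp, initialLp, L2.real_inner_indicatorConstLp_one_indicatorConstLp_one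
      measurableSet_Ioc measurableSet_Ioc (timeMeasure_Ioc_ne_top 0 s) (timeMeasure_Ioc_ne_top 0 t),
    Set.Ioc_inter_Ioc, measureReal_def, timeMeasure, Measure.restrict_apply measurableSet_Ioc,
    Set.inter_eq_left.2 (by simpa using Set.Ioc_subset_Ioi_self), Real.volume_Ioc,
    max_self, sub_zero, ENNReal.toReal_ofReal (by positivity),
    NNReal.coe_min]

lemma memLp_indicator_Ioc {f : ℝ → ℝ} {u : ℝ≥0}
    (hf : MemLp f 2 (volume.restrict (Set.Ioc (0 : ℝ) u))) :
    MemLp ((Set.Ioc (0 : ℝ) u).indicator f) 2 timeMeasure := by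
  rwa [memLp_indicator_iff_restrict measurableSet_Ioc, timeMeasure_restrict_Ioc]

section Graph

variable {Ω : Type*} [MeasurableSpace Ω] {P : Measure Ω}

/-- The pair process `(W, W')`, indexed by two copies of the time axis, generates the Wiener
isometry: this is the closed subspace of `L²(0,∞) × L²(0,∞) × L²(P)` spanned by the triples
`(1_{(0,t]}, 0, W_t)` and `(0, 1_{(0,t]}, W'_t)`. For a pair of independent Brownian motions it
consists of the triples `(f, g, ∫ f dW + ∫ g dW')`. -/
def wienerGraph (Z : ℝ≥0 ⊕ ℝ≥0 → Ω → ℝ) (hZ : ∀ t, MemLp (Z t) 2 P) :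
    Submodule ℝ (Lp ℝ 2 timeMeasure × Lp ℝ 2 timeMeasure × Lp ℝ 2 P) :=
  (Submodule.span ℝ (Set.range fun t ↦
    (Sum.elim initialLp 0 t, Sum.elim 0 initialLp t, (hZ t).toLp (Z t)))).topologicalClosure

lemma mem_closure_span_of_mem_wienerGraph {Z : ℝ≥0 ⊕ ℝ≥0 → Ω → ℝ} {hZ : ∀ t, MemLp (Z t) 2 P}
    {p : Lp ℝ 2 timeMeasure × Lp ℝ 2 timeMeasure × Lp ℝ 2 P} (hp : p ∈ wienerGraph Z hZ) :
    p.2.2 ∈ (Submodule.span ℝ (Set.range fun t ↦ (hZ t).toLp (Z t))).topologicalClosure := by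
  refine map_mem_closure (f := fun p : Lp ℝ 2 timeMeasure × Lp ℝ 2 timeMeasure × Lp ℝ 2 P ↦ p.2.2)
    (by fun_prop) hp fun q hq ↦ ?_
  refine Submodule.span_induction (p := fun q _ ↦ q.2.2 ∈
    Submodule.span ℝ (Set.range fun t ↦ (hZ t).toLp (Z t))) ?_ ?_ ?_ ?_ hq
  · rintro _ ⟨t, rfl⟩
    exact Submodule.subset_span ⟨t, rfl⟩
  · exact zero_mem _
  · exact fun _ _ _ _ h1 h2 ↦ add_mem h1 h2
  · exact fun c _ _ h ↦ Submodule.smul_mem _ c h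

/-- The isometry holds on the generators by `hcov`, on the span by bilinearity, and on the graph by
continuity in each argument in turn. -/
lemma inner_of_mem_wienerGraph [IsProbabilityMeasure P] {Z : ℝ≥0 ⊕ ℝ≥0 → Ω → ℝ}
    {hZ : ∀ t, MemLp (Z t) 2 P} (h0 : ∀ t, ∫ ω, Z t ω ∂P = 0)
    (hcov : ∀ s t, cov[Z s, Z t; P] =
      inner ℝ (Sum.elim initialLp 0 s) (Sum.elim initialLp 0 t : Lp ℝ 2 timeMeasure)
      + inner ℝ (Sum.elim 0 initialLp s) (Sum.elim 0 initialLp t : Lp ℝ 2 timeMeasure))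
    {p q : Lp ℝ 2 timeMeasure × Lp ℝ 2 timeMeasure × Lp ℝ 2 P}
    (hp : p ∈ wienerGraph Z hZ) (hq : q ∈ wienerGraph Z hZ) :
    inner ℝ p.2.2 q.2.2 = inner ℝ p.1 q.1 + inner ℝ p.2.1 q.2.1 := by
  have hspan : ∀ p ∈ Submodule.span ℝ (Set.range fun t ↦
      (Sum.elim initialLp 0 t, Sum.elim 0 initialLp t, (hZ t).toLp (Z t))),
      ∀ q ∈ Submodule.span ℝ (Set.range fun t ↦
      (Sum.elim initialLp 0 t, Sum.elim 0 initialLp t, (hZ t).toLp (Z t))),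
      inner ℝ p.2.2 q.2.2 = inner ℝ p.1 q.1 + inner ℝ p.2.1 q.2.1 := by
    intro p hp q hq
    refine Submodule.span_induction₂ (p := fun p q _ _ ↦
      inner ℝ p.2.2 q.2.2 = inner ℝ p.1 q.1 + inner ℝ p.2.1 q.2.1) ?_ ?_ ?_ ?_ ?_ ?_ ?_ hp hq
    · rintro _ _ ⟨s, rfl⟩ ⟨t, rfl⟩
      dsimp only
      rw [← hcov, covariance_eq_sub (hZ s) (hZ t), h0, zero_mul, sub_zero, L2.inner_def]
      refine integral_congr_ae ?_
      filter_upwards [(hZ s).coeFn_toLp, (hZ t).coeFn_toLp] with ω h1 h2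
      simp [h1, h2, mul_comm]
    · simp
    · simp
    · intro x y z _ _ _ h1 h2
      simp only [Prod.fst_add, Prod.snd_add, inner_add_left, h1, h2]
      ring
    · intro x y z _ _ _ h1 h2
      simp only [Prod.fst_add, Prod.snd_add, inner_add_right, h1, h2]
      ring
    · intro r x y _ _ h
      simp only [Prod.smul_fst, Prod.smul_snd, real_inner_smul_left, h]
      ring
    · intro r x y _ _ h
      simp only [Prod.smul_fst, Prod.smul_snd, real_inner_smul_right, h]
      ring
  have hstep : ∀ p ∈ wienerGraph Z hZ, ∀ q ∈ Submodule.span ℝ (Set.range fun t ↦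
      (Sum.elim initialLp 0 t, Sum.elim 0 initialLp t, (hZ t).toLp (Z t))),
      inner ℝ p.2.2 q.2.2 = inner ℝ p.1 q.1 + inner ℝ p.2.1 q.2.1 := fun p hp q hq ↦
    closure_minimal (fun p hp ↦ hspan p hp q hq)
      (isClosed_eq (f := fun p : Lp ℝ 2 timeMeasure × Lp ℝ 2 timeMeasure × Lp ℝ 2 P ↦
          inner ℝ p.2.2 q.2.2) (g := fun p ↦ inner ℝ p.1 q.1 + inner ℝ p.2.1 q.2.1)
        (by fun_prop) (by fun_prop)) hp
  exact closure_minimal (fun q hq ↦ hstep p hp q hq)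
    (isClosed_eq (f := fun q : Lp ℝ 2 timeMeasure × Lp ℝ 2 timeMeasure × Lp ℝ 2 P ↦
        inner ℝ p.2.2 q.2.2) (g := fun q ↦ inner ℝ p.1 q.1 + inner ℝ p.2.1 q.2.1)
      (by fun_prop) (by fun_prop)) hq

end Graph

section Pair

variable {Ω : Type*} [MeasurableSpace Ω] {P : Measure Ω} {W W' : ℝ≥0 → Ω → ℝ}

/-- Two independent Gaussian processes are jointly Gaussian. -/
lemma isGaussianProcess_sumElim (hW : IsGaussianProcess W P) (hW' : IsGaussianProcess W' P)
    (hind : IndepFun (fun ω t ↦ W t ω) (fun ω t ↦ W' t ω) P) :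
    IsGaussianProcess (Sum.elim W W') P where
  hasGaussianLaw I := by
    classical
    have hm := hind.comp (φ := fun x (i : I.toLeft) ↦ x i) (ψ := fun x (i : I.toRight) ↦ x i)
      (by fun_prop) (by fun_prop)
    have h := hm.hasGaussianLaw (hW.hasGaussianLaw I.toLeft) (hW'.hasGaussianLaw I.toRight)
    let L : ((I.toLeft → ℝ) × (I.toRight → ℝ)) →L[ℝ] (I → ℝ) := ContinuousLinearMap.pi fun i ↦
      match i with
      | ⟨.inl s, hs⟩ => (ContinuousLinearMap.proj ⟨s, Finset.mem_toLeft.2 hs⟩).comp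
          (ContinuousLinearMap.fst ℝ _ _)
      | ⟨.inr s, hs⟩ => (ContinuousLinearMap.proj ⟨s, Finset.mem_toRight.2 hs⟩).comp
          (ContinuousLinearMap.snd ℝ _ _)
    have hL : (fun ω ↦ I.restrict (fun t ↦ Sum.elim W W' t ω)) = fun ω ↦
        L (I.toLeft.restrict fun t ↦ W t ω, I.toRight.restrict fun t ↦ W' t ω) := by
      funext ω ⟨i, hi⟩
      rcases i with i | i <;> rfl
    exact hL ▸ h.map_fun L

/-- `W` and `W'` are independent and have the finite-dimensional laws of Brownian motions. -/
structure IsBrownianPair (W W' : ℝ≥0 → Ω → ℝ) (P : Measure Ω) : Prop where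
  left : IsPreBrownianReal W P
  right : IsPreBrownianReal W' P
  indep : IndepFun (fun ω t ↦ W t ω) (fun ω t ↦ W' t ω) P

namespace IsBrownianPair

lemma isProbabilityMeasure (hB : IsBrownianPair W W' P) : IsProbabilityMeasure P :=
  hB.left.isGaussianProcess.isProbabilityMeasure

lemma memLp (hB : IsBrownianPair W W' P) (t : ℝ≥0 ⊕ ℝ≥0) : MemLp (Sum.elim W W' t) 2 P := by
  rcases t with t | t
  · exact (hB.left.isGaussianProcess.hasGaussianLaw_eval t).memLp_two
  · exact (hB.right.isGaussianProcess.hasGaussianLaw_eval t).memLp_two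

lemma integral_eq_zero (h : IsBrownianPair W W' P) (t : ℝ≥0 ⊕ ℝ≥0) :
    ∫ ω, Sum.elim W W' t ω ∂P = 0 := by
  rcases t with t | t
  · exact h.left.integral_eval t
  · exact h.right.integral_eval t

lemma covariance_eq_inner (h : IsBrownianPair W W' P) (s t : ℝ≥0 ⊕ ℝ≥0) :
    cov[Sum.elim W W' s, Sum.elim W W' t; P] =
      inner ℝ (Sum.elim initialLp 0 s) (Sum.elim initialLp 0 t : Lp ℝ 2 timeMeasure)
      + inner ℝ (Sum.elim 0 initialLp s) (Sum.elim 0 initialLp t : Lp ℝ 2 timeMeasure) := by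
  have := h.isProbabilityMeasure
  have hi (s t : ℝ≥0) : cov[W s, W' t; P] = 0 :=
    (h.indep.comp (measurable_pi_apply s) (measurable_pi_apply t)).covariance_eq_zero
      (h.memLp (.inl s)) (h.memLp (.inr t))
  rcases s with s | s <;> rcases t with t | t
  · simp [h.left.covariance_eval, inner_initialLp]
  · simp [hi]
  · simp [covariance_comm (W' s), hi]
  · simp [h.right.covariance_eval, inner_initialLp]

/-- The triples `(f, g, ∫ f dW + ∫ g dW')` with `f, g ∈ L²(0,∞)`. -/
abbrev graph (h : IsBrownianPair W W' P) :
    Submodule ℝ (Lp ℝ 2 timeMeasure × Lp ℝ 2 timeMeasure × Lp ℝ 2 P) :=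
  wienerGraph (Sum.elim W W') h.memLp

/-- The **Wiener isometry** in polarized form. -/
lemma inner_eq (h : IsBrownianPair W W' P)
    {p q : Lp ℝ 2 timeMeasure × Lp ℝ 2 timeMeasure × Lp ℝ 2 P}
    (hp : p ∈ h.graph) (hq : q ∈ h.graph) :
    inner ℝ p.2.2 q.2.2 = inner ℝ p.1 q.1 + inner ℝ p.2.1 q.2.1 :=
  have := h.isProbabilityMeasure
  inner_of_mem_wienerGraph h.integral_eq_zero h.covariance_eq_inner hp hq

lemma norm_le (h : IsBrownianPair W W' P)
    {p : Lp ℝ 2 timeMeasure × Lp ℝ 2 timeMeasure × Lp ℝ 2 P} (hp : p ∈ h.graph) :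
    ‖p.2.2‖ ≤ ‖p.1‖ + ‖p.2.1‖ := by
  have := h.inner_eq hp hp
  simp only [real_inner_self_eq_norm_sq] at this
  refine le_of_sq_le_sq ?_ (by positivity)
  nlinarith [norm_nonneg p.1, norm_nonneg p.2.1, mul_nonneg (norm_nonneg p.1) (norm_nonneg p.2.1)]

/-- The Gaussian Hilbert space generated by `W` and `W'`. -/
def space (h : IsBrownianPair W W' P) : Submodule ℝ (Lp ℝ 2 P) :=
  (Submodule.span ℝ (Set.range fun t ↦ (h.memLp t).toLp (Sum.elim W W' t))).topologicalClosure

lemma isCenteredGaussianSpace (hB : IsBrownianPair W W' P) :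
    IsCenteredGaussianSpace P hB.space :=
  have := hB.isProbabilityMeasure
  (isCenteredGaussianSpace_span (isGaussianProcess_sumElim hB.left.isGaussianProcess
    hB.right.isGaussianProcess hB.indep) hB.integral_eq_zero hB.memLp).topologicalClosure

lemma mem_space (h : IsBrownianPair W W' P)
    {p : Lp ℝ 2 timeMeasure × Lp ℝ 2 timeMeasure × Lp ℝ 2 P} (hp : p ∈ h.graph) :
    p.2.2 ∈ h.space :=
  mem_closure_span_of_mem_wienerGraph hp

/-- A Wiener integral is determined almost surely by its integrands. -/
lemma eq_of_mem_graph (h : IsBrownianPair W W' P) {F G : Lp ℝ 2 timeMeasure} {Y Y' : Lp ℝ 2 P}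
    (hY : (F, G, Y) ∈ h.graph) (hY' : (F, G, Y') ∈ h.graph) : Y = Y' := by
  have := h.norm_le (sub_mem hY hY')
  simp only [Prod.mk_sub_mk, sub_self, norm_zero, add_zero] at this
  exact sub_eq_zero.1 (norm_le_zero_iff.1 this)

lemma memLp_mixed (h : IsBrownianPair W W' P) (a b : ℝ) (t : ℝ≥0) :
    MemLp (mixedProcess a b W W' t) 2 P :=
  ((h.memLp (.inl t)).const_mul a).add ((h.memLp (.inr t)).const_mul b)

lemma mixedProcess_mem_graph (h : IsBrownianPair W W' P) (a b : ℝ) (t : ℝ≥0) :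
    (a • initialLp t, b • initialLp t, (h.memLp_mixed a b t).toLp _) ∈ h.graph := by
  have h1 : (initialLp t, (0 : Lp ℝ 2 timeMeasure), (h.memLp (.inl t)).toLp (W t)) ∈ h.graph :=
    Submodule.le_topologicalClosure _ (Submodule.subset_span ⟨.inl t, rfl⟩)
  have h2 : ((0 : Lp ℝ 2 timeMeasure), initialLp t, (h.memLp (.inr t)).toLp (W' t)) ∈ h.graph :=
    Submodule.le_topologicalClosure _ (Submodule.subset_span ⟨.inr t, rfl⟩)
  convert add_mem (Submodule.smul_mem _ a h1) (Submodule.smul_mem _ b h2) using 1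
  simp only [Prod.smul_mk, Prod.mk_add_mk, smul_zero, add_zero, zero_add]
  rfl

end IsBrownianPair

end Pair

/-! ### Wiener integrals in the graph of the isometry -/

lemma toLp_finsetSum {α ι : Type*} [MeasurableSpace α] {μ : Measure α} (s : Finset ι)
    {f : ι → α → ℝ} (hf : ∀ i, MemLp (f i) 2 μ) (h : MemLp (∑ i ∈ s, f i) 2 μ) :
    h.toLp = ∑ i ∈ s, (hf i).toLp := by
  refine Lp.ext ?_
  have h1 : ∀ᵐ x ∂μ, ∀ i ∈ s, (hf i).toLp (f i) x = f i x := by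
    rw [Finset.eventually_all]
    exact fun i _ ↦ (hf i).coeFn_toLp
  filter_upwards [h.coeFn_toLp, Lp.coeFn_finsetSum s fun i ↦ (hf i).toLp (f i), h1] with x h2 h3 h4
  rw [h2, h3, Finset.sum_apply, Finset.sum_apply]
  exact Finset.sum_congr rfl fun i hi ↦ (h4 i hi).symm

namespace StepFun

lemma indicator_Ioc_eq_sub (φ : StepFun) (i : Fin φ.n) :
    (Set.Ioc (φ.left i : ℝ) (φ.right i : ℝ)).indicator (1 : ℝ → ℝ) =
      (Set.Ioc (0 : ℝ) (φ.right i)).indicator 1 - (Set.Ioc (0 : ℝ) (φ.left i)).indicator 1 := by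
  rw [← Set.Ioc_union_Ioc_eq_Ioc (φ.left i).coe_nonneg (NNReal.coe_le_coe.2 (φ.left_le_right i)),
    Set.indicator_union_of_disjoint (Set.Ioc_disjoint_Ioc_of_le le_rfl)]
  ext v
  simp

lemma exists_toLp_eval (φ : StepFun) : ∃ hφ : MemLp φ.eval 2 timeMeasure,
    hφ.toLp = ∑ i, φ.coeff i • (initialLp (φ.right i) - initialLp (φ.left i)) := by
  have h1 (t : ℝ≥0) : MemLp ((Set.Ioc (0 : ℝ) t).indicator (1 : ℝ → ℝ)) 2 timeMeasure :=
    memLp_indicator_Ioc (memLp_const 1)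
  have he : φ.eval = ∑ i, φ.coeff i • ((Set.Ioc (0 : ℝ) (φ.right i)).indicator (1 : ℝ → ℝ) -
      (Set.Ioc (0 : ℝ) (φ.left i)).indicator 1) := by
    ext v
    simp [StepFun.eval, φ.indicator_Ioc_eq_sub]
  have h2 (i : Fin φ.n) := ((h1 (φ.right i)).sub (h1 (φ.left i))).const_smul (φ.coeff i)
  have h3 := memLp_finsetSum' Finset.univ fun i _ ↦ h2 i
  refine ⟨he ▸ h3, ?_⟩
  simp only [he]
  rw [toLp_finsetSum Finset.univ h2]
  rfl

lemma memLp_eval (φ : StepFun) : MemLp φ.eval 2 timeMeasure := φ.exists_toLp_eval.1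

/-- The restriction of a step function to `(0,u]`. -/
def truncate (φ : StepFun) (u : ℝ≥0) : StepFun where
  n := φ.n
  coeff := φ.coeff
  left i := min (φ.left i) u
  right i := min (φ.right i) u
  left_le_right i := min_le_min_right u (φ.left_le_right i)

lemma truncate_eval (φ : StepFun) (u : ℝ≥0) :
    (φ.truncate u).eval = (Set.Ioc (0 : ℝ) u).indicator φ.eval := by
  ext v
  have h (i : Fin φ.n) : (Set.Ioc (((min (φ.left i) u : ℝ≥0)) : ℝ)
      ((min (φ.right i) u : ℝ≥0) : ℝ)).indicator (1 : ℝ → ℝ) v =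
      (Set.Ioc (0 : ℝ) u).indicator
        ((Set.Ioc (φ.left i : ℝ) (φ.right i : ℝ)).indicator (1 : ℝ → ℝ)) v := by
    rw [Set.indicator_indicator]
    congr 1
    ext x
    have := (φ.left i).coe_nonneg
    simp only [NNReal.coe_min, Set.mem_Ioc, Set.mem_inter_iff, min_lt_iff, le_min_iff]
    grind
  by_cases hv : v ∈ Set.Ioc (0 : ℝ) u
  · simp only [eval, truncate, h, hv, Set.indicator_of_mem]
    rfl
  · simp only [eval, truncate, h, hv, not_false_eq_true, Set.indicator_of_notMem, mul_zero,
      Finset.sum_const_zero]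

lemma truncate_eq_self (φ : StepFun) {u : ℝ≥0} (h : ∀ i, φ.right i ≤ u) : φ.truncate u = φ := by
  have hl : (fun i ↦ min (φ.left i) u) = φ.left :=
    funext fun i ↦ min_eq_left ((φ.left_le_right i).trans (h i))
  have hr : (fun i ↦ min (φ.right i) u) = φ.right := funext fun i ↦ min_eq_left (h i)
  simp only [truncate, hl, hr]

lemma eLpNorm_eval_sub_indicator (φ : StepFun) {u : ℝ≥0} (h : ∀ i, φ.right i ≤ u) (f : ℝ → ℝ) :
    eLpNorm (φ.eval - (Set.Ioc (0 : ℝ) u).indicator f) 2 timeMeasure =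
      eLpNorm (fun v ↦ φ.eval v - f v) 2 (volume.restrict (Set.Ioc (0 : ℝ) u)) := by
  have h1 : φ.eval - (Set.Ioc (0 : ℝ) u).indicator f =
      (Set.Ioc (0 : ℝ) u).indicator fun v ↦ φ.eval v - f v := by
    conv_lhs => rw [← φ.truncate_eq_self h, truncate_eval, ← Set.indicator_sub']
    rfl
  rw [h1, eLpNorm_indicator_eq_eLpNorm_restrict measurableSet_Ioc, timeMeasure_restrict_Ioc]

end StepFun

section Pair

variable {Ω : Type*} [MeasurableSpace Ω] {P : Measure Ω} {W W' : ℝ≥0 → Ω → ℝ}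

namespace IsBrownianPair

lemma exists_step_mem_graph (h : IsBrownianPair W W' P) (a b : ℝ) (φ : StepFun) :
    ∃ hI : MemLp (φ.integral (mixedProcess a b W W')) 2 P,
      (a • φ.memLp_eval.toLp, b • φ.memLp_eval.toLp, hI.toLp) ∈ h.graph := by
  have he : φ.integral (mixedProcess a b W W') = ∑ i, φ.coeff i •
      (mixedProcess a b W W' (φ.right i) - mixedProcess a b W W' (φ.left i)) := by
    ext ω
    simp [StepFun.integral]
  have h2 (i : Fin φ.n) := ((h.memLp_mixed a b (φ.right i)).sub
    (h.memLp_mixed a b (φ.left i))).const_smul (φ.coeff i)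
  have h3 := memLp_finsetSum' Finset.univ fun i _ ↦ h2 i
  refine ⟨he ▸ h3, ?_⟩
  simp only [he]
  rw [toLp_finsetSum Finset.univ h2, φ.exists_toLp_eval.2]
  have h4 : ∑ i, φ.coeff i •
      ((a • initialLp (φ.right i), b • initialLp (φ.right i),
        (h.memLp_mixed a b (φ.right i)).toLp _) -
      (a • initialLp (φ.left i), b • initialLp (φ.left i),
        (h.memLp_mixed a b (φ.left i)).toLp _)) ∈ h.graph :=
    sum_mem fun i _ ↦ Submodule.smul_mem _ _
      (sub_mem (h.mixedProcess_mem_graph a b _) (h.mixedProcess_mem_graph a b _))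
  convert h4 using 1
  simp only [Prod.mk_sub_mk, Prod.smul_mk]
  refine Prod.ext ?_ (Prod.ext ?_ ?_)
  · simp [Prod.fst_sum, Finset.smul_sum, smul_sub, smul_comm a]
  · simp [Prod.fst_sum, Prod.snd_sum, Finset.smul_sum, smul_sub, smul_comm b]
  · simp only [Prod.snd_sum]
    rfl

/-- A Wiener integral with respect to `a W + b W'` is the value of the Wiener isometry at the pair
`(a f, b f)`. -/
lemma exists_mem_graph_of_isWienerIntegral (h : IsBrownianPair W W' P) {a b : ℝ} {f : ℝ → ℝ}
    {u : ℝ≥0} (hf : MemLp f 2 (volume.restrict (Set.Ioc (0 : ℝ) u))) {Y : Ω → ℝ}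
    (hY : IsWienerIntegral P (mixedProcess a b W W') f u Y) :
    ∃ hYL : MemLp Y 2 P, (a • (memLp_indicator_Ioc hf).toLp, b • (memLp_indicator_Ioc hf).toLp,
      hYL.toLp) ∈ h.graph := by
  obtain ⟨hYm, φ, hφu, hφ, hI⟩ := hY
  choose hIL hmem using fun n ↦ h.exists_step_mem_graph a b (φ n)
  have hYL : MemLp Y 2 P := by
    obtain ⟨n, hn⟩ := (hI.eventually (gt_mem_nhds ENNReal.zero_lt_top)).exists
    have : MemLp (fun ω ↦ (φ n).integral (mixedProcess a b W W') ω - Y ω) 2 P :=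
      ⟨(hIL n).aestronglyMeasurable.sub hYm, hn⟩
    convert (hIL n).sub this using 1
    ext ω
    simp
  refine ⟨hYL, ?_⟩
  have h1 : Tendsto (fun n ↦ (φ n).memLp_eval.toLp) atTop (𝓝 (memLp_indicator_Ioc hf).toLp) := by
    rw [Lp.tendsto_Lp_iff_tendsto_eLpNorm'']
    simpa only [(φ _).eLpNorm_eval_sub_indicator (hφu _)] using hφ
  have h2 : Tendsto (fun n ↦ (hIL n).toLp) atTop (𝓝 hYL.toLp) := by
    rw [Lp.tendsto_Lp_iff_tendsto_eLpNorm'']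
    exact hI
  exact (Submodule.isClosed_topologicalClosure _).mem_of_tendsto
    ((h1.const_smul a).prodMk_nhds ((h1.const_smul b).prodMk_nhds h2))
    (Eventually.of_forall hmem)

/-- Measurability of the step integrals passes to the limit, so a square integrable function that
is approximated by step functions has a Wiener integral measurable with respect to the past. -/
lemma exists_isWienerIntegral (h : IsBrownianPair W W' P) (hWm : ∀ t, Measurable (W t))
    (hW'm : ∀ t, Measurable (W' t)) (a b : ℝ) {f : ℝ → ℝ} {u : ℝ≥0}
    (hf : MemLp f 2 (volume.restrict (Set.Ioc (0 : ℝ) u))) {φ : ℕ → StepFun}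
    (hφu : ∀ n i, (φ n).right i ≤ u)
    (hφ : Tendsto (fun n ↦ eLpNorm (fun v ↦ (φ n).eval v - f v) 2
      (volume.restrict (Set.Ioc (0 : ℝ) u))) atTop (𝓝 0)) :
    ∃ Y : Ω → ℝ, Measurable[pastSigma (mixedProcess a b W W') u] Y ∧
      IsWienerIntegral P (mixedProcess a b W W') f u Y := by
  have hm : pastSigma (mixedProcess a b W W') u ≤ ‹MeasurableSpace Ω› :=
    iSup₂_le fun v _ ↦ (((hWm v).const_mul a).add ((hW'm v).const_mul b)).comap_le
  choose hIL hmem using fun n ↦ h.exists_step_mem_graph a b (φ n)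
  have h1 : Tendsto (fun n ↦ (φ n).memLp_eval.toLp) atTop (𝓝 (memLp_indicator_Ioc hf).toLp) := by
    rw [Lp.tendsto_Lp_iff_tendsto_eLpNorm'']
    simpa only [(φ _).eLpNorm_eval_sub_indicator (hφu _)] using hφ
  -- By the isometry, convergence of the integrands makes the step integrals a Cauchy sequence.
  have hC : CauchySeq fun n ↦ (hIL n).toLp := by
    rw [cauchySeq_iff_tendsto_dist_atTop_0]
    have ha := cauchySeq_iff_tendsto_dist_atTop_0.1 (h1.const_smul a).cauchySeq
    have hb := cauchySeq_iff_tendsto_dist_atTop_0.1 (h1.const_smul b).cauchySeq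
    refine squeeze_zero (fun _ ↦ dist_nonneg) (fun n ↦ ?_) (by simpa using ha.add hb)
    simp only [dist_eq_norm]
    have := h.norm_le (sub_mem (hmem n.1) (hmem n.2))
    simpa only [Prod.mk_sub_mk] using this
  obtain ⟨Y, hY⟩ := cauchySeq_tendsto_of_complete hC
  have hmeas (v : ℝ≥0) (hv : v ≤ u) :
      Measurable[pastSigma (mixedProcess a b W W') u] (mixedProcess a b W W' v) :=
    Measurable.mono (comap_measurable _) (le_iSup₂_of_le v hv le_rfl) le_rfl
  have hYm : AEStronglyMeasurable[pastSigma (mixedProcess a b W W') u] Y P := by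
    refine (isClosed_aestronglyMeasurable hm).mem_of_tendsto hY (Eventually.of_forall fun n ↦ ?_)
    refine AEStronglyMeasurable.congr ?_ (hIL n).coeFn_toLp.symm
    refine (Measurable.stronglyMeasurable ?_).aestronglyMeasurable
    unfold StepFun.integral
    refine Finset.measurable_fun_sum _ fun i _ ↦ Measurable.const_mul ?_ _
    exact (hmeas _ (hφu n i)).sub (hmeas _ (((φ n).left_le_right i).trans (hφu n i)))
  refine ⟨hYm.mk Y, hYm.stronglyMeasurable_mk.measurable,
    (hYm.stronglyMeasurable_mk.mono hm).aestronglyMeasurable, φ, hφu, hφ, ?_⟩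
  have hYL : MemLp (hYm.mk Y) 2 P := (Lp.memLp Y).ae_eq hYm.ae_eq_mk
  have he : Y = hYL.toLp := Lp.ext (hYm.ae_eq_mk.trans hYL.coeFn_toLp.symm)
  rw [he, Lp.tendsto_Lp_iff_tendsto_eLpNorm''] at hY
  exact hY

end IsBrownianPair

end Pair

/-! ### The prediction residual -/

lemma inner_toLp {f g : ℝ → ℝ} (hf : MemLp f 2 timeMeasure) (hg : MemLp g 2 timeMeasure) :
    inner ℝ hf.toLp hg.toLp = ∫ v in Set.Ioi (0 : ℝ), f v * g v := by
  rw [L2.inner_def]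
  refine integral_congr_ae ?_
  filter_upwards [hf.coeFn_toLp, hg.coeFn_toLp] with v h1 h2
  simp [h1, h2, mul_comm]

/-- The indicator in `initialLp` as the class of a function. -/
lemma initialLp_eq_toLp (t : ℝ≥0) :
    initialLp t = (memLp_indicator_Ioc (u := t) (f := fun _ ↦ (1 : ℝ)) (memLp_const 1)).toLp := rfl

section Kernel

variable {k : ℝ → ℝ → ℝ}

/-- A Volterra kernel is square integrable over any bounded interval, being zero after `t`. -/
lemma memLp_volterra (hk : ∀ t : ℝ≥0, MemLp (k t) 2 (volume.restrict (Set.Ioc (0 : ℝ) t)))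
    (hk0 : ∀ t s : ℝ≥0, t < s → k t s = 0) (t u : ℝ≥0) :
    MemLp (k t) 2 (volume.restrict (Set.Ioc (0 : ℝ) u)) := by
  have h := memLp_indicator_Ioc (hk t)
  have h2 : MemLp ((Set.Ioc (0 : ℝ) t).indicator (k t)) 2 (volume.restrict (Set.Ioc (0 : ℝ) u)) :=
    h.mono_measure (Measure.restrict_mono Set.Ioc_subset_Ioi_self le_rfl)
  refine h2.ae_eq ?_
  filter_upwards [ae_restrict_mem measurableSet_Ioc] with v hv
  by_cases hvt : v ≤ t
  · rw [Set.indicator_of_mem (show v ∈ Set.Ioc (0 : ℝ) t from ⟨hv.1, hvt⟩)]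
  · rw [Set.indicator_of_notMem fun h ↦ hvt h.2]
    exact (hk0 t ⟨v, hv.1.le⟩ (not_le.1 hvt)).symm

lemma indicator_Ioc_volterra (hk0 : ∀ t s : ℝ≥0, t < s → k t s = 0) (t : ℝ≥0) {v : ℝ}
    (hv : 0 < v) : (Set.Ioc (0 : ℝ) t).indicator (k t) v = k t v := by
  by_cases hvt : v ≤ t
  · rw [Set.indicator_of_mem (show v ∈ Set.Ioc (0 : ℝ) t from ⟨hv, hvt⟩)]
  · rw [Set.indicator_of_notMem fun h ↦ hvt h.2]
    exact (hk0 t ⟨v, hv.le⟩ (not_le.1 hvt)).symm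

lemma setIntegral_indicator_mul (u : ℝ≥0) (f g : ℝ → ℝ) :
    ∫ v in Set.Ioi (0 : ℝ), (Set.Ioc (0 : ℝ) u).indicator f v * g v =
      ∫ v in (0 : ℝ)..u, f v * g v := by
  rw [intervalIntegral.integral_of_le u.coe_nonneg, ← timeMeasure_restrict_Ioc u,
    ← integral_indicator measurableSet_Ioc]
  refine integral_congr_ae (ae_of_all _ fun v ↦ ?_)
  by_cases hv : v ∈ Set.Ioc (0 : ℝ) u <;> simp [hv]

/-- The integral over `[0,t ∧ s]` in the prediction covariance as an inner product in `L²(0,∞)`. -/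
lemma integral_residual_mul (hk0 : ∀ t s : ℝ≥0, t < s → k t s = 0) (c : ℝ) (u t s : ℝ≥0) :
    ∫ v in Set.Ioi (0 : ℝ),
      ((Set.Ioc (0 : ℝ) t).indicator (k t) v - c * (Set.Ioc (0 : ℝ) u).indicator (k t) v) *
      ((Set.Ioc (0 : ℝ) s).indicator (k s) v - c * (Set.Ioc (0 : ℝ) u).indicator (k s) v) =
    ∫ v in (0 : ℝ)..(min t s : ℝ≥0),
      (1 - c * (Set.Ico (0 : ℝ) u).indicator 1 v) ^ 2 * k t v * k s v := by
  -- At `v = u` the indicators of `[0,u)` and `(0,u]` differ.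
  have hne : ∀ᵐ v ∂timeMeasure, v ≠ (u : ℝ) := ae_restrict_of_ae (by
    simp [ae_iff])
  rw [intervalIntegral.integral_of_le (min t s).coe_nonneg, ← timeMeasure_restrict_Ioc (min t s),
    ← integral_indicator measurableSet_Ioc]
  refine integral_congr_ae ?_
  filter_upwards [hne, ae_restrict_mem measurableSet_Ioi] with v hvu hv
  have hv0 : (0 : ℝ) < v := hv
  have hu (t : ℝ≥0) : (Set.Ioc (0 : ℝ) u).indicator (k t) v =
      (Set.Ico (0 : ℝ) u).indicator 1 v * k t v := by
    by_cases h : v < u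
    · rw [Set.indicator_of_mem (show v ∈ Set.Ioc (0 : ℝ) u from ⟨hv0, h.le⟩),
        Set.indicator_of_mem (show v ∈ Set.Ico (0 : ℝ) u from ⟨hv0.le, h⟩)]
      simp
    · rw [Set.indicator_of_notMem, Set.indicator_of_notMem, zero_mul]
      · exact fun h' ↦ h h'.2
      · exact fun h' ↦ h (lt_of_le_of_ne h'.2 hvu)
  rw [hu, hu, indicator_Ioc_volterra hk0 t hv0, indicator_Ioc_volterra hk0 s hv0]
  by_cases hm : v ∈ Set.Ioc (0 : ℝ) (min t s : ℝ≥0)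
  · rw [Set.indicator_of_mem hm]
    ring
  · rw [Set.indicator_of_notMem hm]
    have h0 (r : ℝ≥0) (hr : (r : ℝ) < v) : k r v = 0 := hk0 r ⟨v, hv0.le⟩ hr
    have : (t : ℝ) < v ∨ (s : ℝ) < v := by
      by_contra! hc
      exact hm ⟨hv0, by rw [NNReal.coe_min]; exact le_min hc.1 hc.2⟩
    rcases this with h | h
    · simp [h0 t h]
    · simp [h0 s h]

end Kernel

section Pair

variable {Ω : Type*} [MeasurableSpace Ω] {P : Measure Ω} {W W' : ℝ≥0 → Ω → ℝ}

namespace IsBrownianPair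

lemma integral_eq_zero_of_mem_graph (h : IsBrownianPair W W' P) {F G : Lp ℝ 2 timeMeasure}
    {Y : Ω → ℝ} {hY : MemLp Y 2 P} (hmem : (F, G, hY.toLp) ∈ h.graph) : ∫ ω, Y ω ∂P = 0 := by
  rw [← h.isCenteredGaussianSpace.integral_eq_zero (h.mem_space hmem)]
  exact integral_congr_ae hY.coeFn_toLp.symm

lemma covariance_eq_of_mem_graph (h : IsBrownianPair W W' P) {F G F' G' : Lp ℝ 2 timeMeasure}
    {Y Y' : Ω → ℝ} {hY : MemLp Y 2 P} {hY' : MemLp Y' 2 P} (hmem : (F, G, hY.toLp) ∈ h.graph)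
    (hmem' : (F', G', hY'.toLp) ∈ h.graph) : cov[Y, Y'; P] = inner ℝ F F' + inner ℝ G G' := by
  have := h.isProbabilityMeasure
  rw [covariance_eq_sub hY hY', h.integral_eq_zero_of_mem_graph hmem, zero_mul, sub_zero,
    ← h.inner_eq hmem hmem', L2.inner_def]
  refine integral_congr_ae ?_
  filter_upwards [hY.coeFn_toLp, hY'.coeFn_toLp] with ω h1 h2
  simp [h1, h2, mul_comm]

lemma isGaussianProcess_of_mem_graph (hB : IsBrownianPair W W' P) {T : Type*} {Z : T → Ω → ℝ}
    (hZ : ∀ t, ∃ (F G : Lp ℝ 2 timeMeasure) (hY : MemLp (Z t) 2 P), (F, G, hY.toLp) ∈ hB.graph) :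
    IsGaussianProcess Z P := by
  choose F G hY hmem using hZ
  exact (hB.isCenteredGaussianSpace.isGaussianProcess fun t ↦ hB.mem_space (hmem t)).congr
    fun t ↦ (hY t).coeFn_toLp

variable {k : ℝ → ℝ → ℝ} {X M : ℝ≥0 → Ω → ℝ} {a b : ℝ} {u : ℝ≥0}

/-- The residual `X_t - a/(a²+b²) ∫_0^u k(t,s) dW^{a,b}_s` as a value of the Wiener isometry. -/
lemma exists_residual_mem_graph (h : IsBrownianPair W W' P)
    (hk : ∀ t : ℝ≥0, MemLp (k t) 2 (volume.restrict (Set.Ioc (0 : ℝ) t)))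
    (hku : ∀ t : ℝ≥0, MemLp (k t) 2 (volume.restrict (Set.Ioc (0 : ℝ) u)))
    (hX : ∀ t : ℝ≥0, IsWienerIntegral P W (k t) t (X t))
    (hM : ∀ t : ℝ≥0, IsWienerIntegral P (mixedProcess a b W W') (k t) u (M t)) (t : ℝ≥0) :
    ∃ hR : MemLp (fun ω ↦ X t ω - a / (a ^ 2 + b ^ 2) * M t ω) 2 P,
      (((memLp_indicator_Ioc (hk t)).sub
          ((memLp_indicator_Ioc (hku t)).const_mul (a ^ 2 / (a ^ 2 + b ^ 2)))).toLp,
        ((memLp_indicator_Ioc (hku t)).const_mul (-(a * b) / (a ^ 2 + b ^ 2))).toLp,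
        hR.toLp) ∈ h.graph := by
  have hW : W = mixedProcess 1 0 W W' := by
    ext t ω
    simp [mixedProcess]
  have hXt := hX t
  rw [hW] at hXt
  obtain ⟨hXL, hXmem⟩ := h.exists_mem_graph_of_isWienerIntegral (hk t) hXt
  obtain ⟨hML, hMmem⟩ := h.exists_mem_graph_of_isWienerIntegral (hku t) (hM t)
  refine ⟨hXL.sub (hML.const_mul _), ?_⟩
  convert sub_mem hXmem (Submodule.smul_mem _ (a / (a ^ 2 + b ^ 2)) hMmem) using 1
  simp only [Prod.smul_mk, Prod.mk_sub_mk, smul_smul, one_smul, zero_smul, zero_sub]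
  refine Prod.ext ?_ (Prod.ext ?_ rfl)
  · have : a / (a ^ 2 + b ^ 2) * a = a ^ 2 / (a ^ 2 + b ^ 2) := by ring
    rw [this]
    rfl
  · have : -(a * b) / (a ^ 2 + b ^ 2) = -(a / (a ^ 2 + b ^ 2) * b) := by ring
    simp only [this, ← neg_smul]
    rfl

lemma measurable_mixedProcess (hWm : ∀ t, Measurable (W t)) (hW'm : ∀ t, Measurable (W' t))
    (a b : ℝ) (t : ℝ≥0) : Measurable (mixedProcess a b W W' t) :=
  ((hWm t).const_mul a).add ((hW'm t).const_mul b)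

/-- The covariance of the residual is the prediction covariance: its `W`-component contributes the
first integral, its `W'`-component the second. -/
lemma covariance_residual (h : IsBrownianPair W W' P)
    (hk : ∀ t : ℝ≥0, MemLp (k t) 2 (volume.restrict (Set.Ioc (0 : ℝ) t)))
    (hk0 : ∀ t s : ℝ≥0, t < s → k t s = 0)
    (hX : ∀ t : ℝ≥0, IsWienerIntegral P W (k t) t (X t))
    (hM : ∀ t : ℝ≥0, IsWienerIntegral P (mixedProcess a b W W') (k t) u (M t)) (t s : ℝ≥0) :
    cov[fun ω ↦ X t ω - a / (a ^ 2 + b ^ 2) * M t ω,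
      fun ω ↦ X s ω - a / (a ^ 2 + b ^ 2) * M s ω; P] = predictionCov k a b u t s := by
  have hku := fun t ↦ memLp_volterra hk hk0 t u
  obtain ⟨_, ht⟩ := h.exists_residual_mem_graph hk hku hX hM t
  obtain ⟨_, hs⟩ := h.exists_residual_mem_graph hk hku hX hM s
  rw [h.covariance_eq_of_mem_graph ht hs, inner_toLp, inner_toLp, predictionCov,
    ← integral_residual_mul hk0]
  congr 1
  have h2 := setIntegral_indicator_mul u (k t) ((Set.Ioc (0 : ℝ) u).indicator (k s))
  have h3 : ∫ v in (0 : ℝ)..u, k t v * k s v =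
      ∫ v in (0 : ℝ)..u, k t v * (Set.Ioc (0 : ℝ) u).indicator (k s) v := by
    rw [intervalIntegral.integral_of_le u.coe_nonneg, intervalIntegral.integral_of_le u.coe_nonneg]
    refine setIntegral_congr_fun measurableSet_Ioc fun v hv ↦ ?_
    simp [hv]
  rw [h3, ← h2, ← integral_const_mul]
  refine integral_congr_ae (ae_of_all _ fun v ↦ ?_)
  simp only [div_eq_mul_inv, ← inv_pow]
  ring

/-- The observation up to time `u` is uncorrelated with the residual: the pairings of the noise
`a W + b W'` with the two parts of the residual are both `a ∫_0^v k(t,s) ds`. -/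
lemma covariance_residual_mixed (h : IsBrownianPair W W' P)
    (hk : ∀ t : ℝ≥0, MemLp (k t) 2 (volume.restrict (Set.Ioc (0 : ℝ) t)))
    (hk0 : ∀ t s : ℝ≥0, t < s → k t s = 0)
    (hX : ∀ t : ℝ≥0, IsWienerIntegral P W (k t) t (X t))
    (hM : ∀ t : ℝ≥0, IsWienerIntegral P (mixedProcess a b W W') (k t) u (M t))
    (hab : a ^ 2 + b ^ 2 ≠ 0) (t : ℝ≥0) {v : ℝ≥0} (hv : v ≤ u) :
    cov[fun ω ↦ X t ω - a / (a ^ 2 + b ^ 2) * M t ω, mixedProcess a b W W' v; P] = 0 := by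
  have hku := fun t ↦ memLp_volterra hk hk0 t u
  obtain ⟨_, ht⟩ := h.exists_residual_mem_graph hk hku hX hM t
  rw [h.covariance_eq_of_mem_graph ht (h.mixedProcess_mem_graph a b v), real_inner_smul_right,
    real_inner_smul_right, initialLp_eq_toLp, inner_toLp, inner_toLp, ← integral_const_mul,
    ← integral_const_mul, ← integral_add]
  · refine integral_eq_zero_of_ae ?_
    filter_upwards [ae_restrict_mem measurableSet_Ioi] with x hx
    have hx0 : (0 : ℝ) < x := hx
    by_cases hxv : x ∈ Set.Ioc (0 : ℝ) v
    · have hxu : x ∈ Set.Ioc (0 : ℝ) u := ⟨hx0, hxv.2.trans hv⟩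
      simp only [Pi.sub_apply, indicator_Ioc_volterra hk0 t hx0, Set.indicator_of_mem hxu,
        Set.indicator_of_mem hxv, Pi.zero_apply]
      field_simp
      ring
    · simp [hxv]
  · exact (MemLp.integrable_mul ((memLp_indicator_Ioc (hk t)).sub
      ((memLp_indicator_Ioc (hku t)).const_mul _))
      (memLp_indicator_Ioc (u := v) (memLp_const (1 : ℝ)))).const_mul a
  · exact (MemLp.integrable_mul ((memLp_indicator_Ioc (hku t)).const_mul _)
      (memLp_indicator_Ioc (u := v) (memLp_const (1 : ℝ)))).const_mul b

/-- The residual is independent of the observation up to time `u`, being jointly Gaussian and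
uncorrelated with it. -/
lemma indep_residual (h : IsBrownianPair W W' P)
    (hWm : ∀ t, Measurable (W t)) (hW'm : ∀ t, Measurable (W' t))
    (hk : ∀ t : ℝ≥0, MemLp (k t) 2 (volume.restrict (Set.Ioc (0 : ℝ) t)))
    (hk0 : ∀ t s : ℝ≥0, t < s → k t s = 0)
    (hX : ∀ t : ℝ≥0, IsWienerIntegral P W (k t) t (X t))
    (hM : ∀ t : ℝ≥0, IsWienerIntegral P (mixedProcess a b W W') (k t) u (M t))
    (hab : a ^ 2 + b ^ 2 ≠ 0) :
    Indep (MeasurableSpace.comap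
      (fun ω t ↦ X t ω - a / (a ^ 2 + b ^ 2) * M t ω) inferInstance)
      (pastSigma (mixedProcess a b W W') u) P := by
  have hku := fun t ↦ memLp_volterra hk hk0 t u
  have hR := h.exists_residual_mem_graph hk hku hX hM
  have hG : IsGaussianProcess (Sum.elim (fun t ω ↦ X t ω - a / (a ^ 2 + b ^ 2) * M t ω)
      (fun v : Set.Iic u ↦ mixedProcess a b W W' v)) P := by
    refine h.isGaussianProcess_of_mem_graph fun t ↦ ?_
    rcases t with t | v
    · exact ⟨_, _, hR t⟩
    · exact ⟨_, _, _, h.mixedProcess_mem_graph a b v⟩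
  have hI := hG.indepFun_of_covariance_eq_zero
    (fun t ↦ (hR t).1.aestronglyMeasurable.aemeasurable)
    (fun v ↦ (measurable_mixedProcess hWm hW'm a b v).aemeasurable)
    (fun t v ↦ h.covariance_residual_mixed hk hk0 hX hM hab t v.2)
  have hp : pastSigma (mixedProcess a b W W') u =
      MeasurableSpace.comap (fun ω (v : Set.Iic u) ↦ mixedProcess a b W W' v ω)
        inferInstance := by
    rw [MeasurableSpace.pi, MeasurableSpace.comap_iSup]
    simp only [MeasurableSpace.comap_comp, Function.comp_def, pastSigma]
    rw [iSup_subtype']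
    rfl
  rw [hp]
  exact hI

end IsBrownianPair

end Pair

/-! ### Conditional laws of an independent random element plus a known shift -/

section Shift

variable {α Ω T : Type*} [MeasurableSpace α] [MeasurableSpace Ω] {P : Measure Ω}

/-- The kernel `y ↦ ν(· - N(y))` of translates of a fixed law `ν`. -/
def shiftKernel (ν : Measure (T → ℝ)) [IsProbabilityMeasure ν] {N : α → T → ℝ}
    (hN : Measurable N) : Kernel α (T → ℝ) :=
  (Kernel.deterministic N hN ×ₖ Kernel.const α ν).map fun p ↦ p.2 + p.1

lemma shiftKernel_apply (ν : Measure (T → ℝ)) [IsProbabilityMeasure ν] {N : α → T → ℝ}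
    (hN : Measurable N) (y : α) : shiftKernel ν hN y = ν.map (· + N y) := by
  rw [shiftKernel, Kernel.map_apply _ (by fun_prop), Kernel.prod_apply, Kernel.deterministic_apply,
    Kernel.const_apply, Measure.dirac_prod, Measure.map_map (by fun_prop) (by fun_prop)]
  rfl

instance isMarkovKernel_shiftKernel (ν : Measure (T → ℝ)) [IsProbabilityMeasure ν] {N : α → T → ℝ}
    (hN : Measurable N) : IsMarkovKernel (shiftKernel ν hN) :=
  Kernel.IsMarkovKernel.map _ (by fun_prop)

/-- `y ↦ ν(· - N(y))` is the conditional law of `R + N(Y)` given `Y` if `R` has law `ν` and is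
independent of `Y`. -/
lemma setLIntegral_shiftKernel [IsProbabilityMeasure P] {Y : Ω → α} (hY : Measurable Y)
    {R : Ω → T → ℝ} (hR : Measurable R) [IsProbabilityMeasure (P.map R)] (hind : IndepFun Y R P)
    {N : α → T → ℝ} (hN : Measurable N) {s : Set α} (hs : MeasurableSet s)
    {A : Set (T → ℝ)} (hA : MeasurableSet A) :
    ∫⁻ ω in Y ⁻¹' s, shiftKernel (P.map R) hN (Y ω) A ∂P =
      P (Y ⁻¹' s ∩ {ω | R ω + N (Y ω) ∈ A}) := by
  have hB : MeasurableSet {p : α × (T → ℝ) | p.1 ∈ s ∧ p.2 + N p.1 ∈ A} :=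
    (measurable_fst hs).inter ((by fun_prop : Measurable fun p : α × (T → ℝ) ↦ p.2 + N p.1) hA)
  -- By independence `(Y, R)` has a product law, so Fubini integrates out `R` first.
  have h1 : P (Y ⁻¹' s ∩ {ω | R ω + N (Y ω) ∈ A}) =
      P.map (fun ω ↦ (Y ω, R ω)) {p : α × (T → ℝ) | p.1 ∈ s ∧ p.2 + N p.1 ∈ A} := by
    rw [Measure.map_apply (hY.prodMk hR) hB]
    rfl
  rw [h1, hind.map_prod_eq_prod_map_map hY.aemeasurable hR.aemeasurable, Measure.prod_apply hB,
    lintegral_map (measurable_measure_prodMk_left hB) hY, ← lintegral_indicator (hY hs)]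
  refine lintegral_congr fun ω ↦ ?_
  by_cases hω : Y ω ∈ s
  · rw [Set.indicator_of_mem (show ω ∈ Y ⁻¹' s from hω), shiftKernel_apply,
      Measure.map_apply (by fun_prop) hA]
    congr 1
    ext x
    simp [hω]
  · rw [Set.indicator_of_notMem (show ω ∉ Y ⁻¹' s from hω)]
    simp [hω]

end Shift

/-- If `R` is independent of `m` and `N` is `m`-measurable, then the conditional law of `R + N`
given `m` is the law of `R` translated by `N`. -/
lemma isRegularCondLaw_shiftKernel {Ω T : Type*} {m mΩ : MeasurableSpace Ω} {P : Measure Ω}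
    [IsProbabilityMeasure P] (hm : m ≤ mΩ) {R : Ω → T → ℝ}
    (hR : Measurable R) [IsProbabilityMeasure (P.map R)]
    (hind : Indep (MeasurableSpace.comap R inferInstance) m P)
    {N : Ω → T → ℝ} (hN : Measurable[m] N) :
    IsRegularCondLaw P m (fun ω ↦ R ω + N ω) (@shiftKernel Ω T m (P.map R) _ N hN) where
  isMarkov := @isMarkovKernel_shiftKernel Ω T m (P.map R) _ N hN
  condProb A hA := by
    have hid : @Measurable Ω Ω mΩ m id := measurable_id'' hm
    have := @isMarkovKernel_shiftKernel Ω T m (P.map R) _ N hN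
    have hI : @IndepFun Ω Ω (T → ℝ) mΩ m _ id R P := by
      refine (@IndepFun_iff_Indep Ω Ω (T → ℝ) mΩ m _ id R P).2 ?_
      rw [MeasurableSpace.comap_id]
      exact hind.symm
    have hXA : MeasurableSet ((fun ω ↦ R ω + N ω) ⁻¹' A) := (hR.add (hN.mono hm le_rfl)) hA
    have hκ : Measurable[m] fun ω ↦ (@shiftKernel Ω T m (P.map R) _ N hN ω).real A :=
      (@Kernel.measurable_coe _ _ m _ _ _ hA).ennreal_toReal
    refine ae_eq_condExp_of_forall_setIntegral_eq hm ?_ ?_ ?_ ?_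
    · exact (integrable_const 1).indicator hXA
    · intro s _ _
      refine (Integrable.of_bound (C := 1) (hκ.mono hm le_rfl).aestronglyMeasurable
        (ae_of_all _ fun ω ↦ ?_)).integrableOn
      rw [Real.norm_of_nonneg measureReal_nonneg]
      exact measureReal_le_one
    · intro s hs _
      have h := @setLIntegral_shiftKernel Ω Ω T m mΩ P _ id hid R hR _ hI N hN s hs A hA
      simp only [id_eq, Set.preimage_id_eq] at h
      simp only [measureReal_def]
      rw [integral_toReal ((@Kernel.measurable_coe _ _ m _ _ _ hA).mono hm le_rfl).aemeasurable
        (ae_of_all _ fun ω ↦ measure_lt_top _ _), h, setIntegral_indicator hXA]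
      simp [measureReal_def]
      rfl
    · exact hκ.aestronglyMeasurable

/-! ### Gaussian laws on function spaces -/

lemma isGaussianLawWith_shift {Ω T : Type*} [MeasurableSpace Ω] {P : Measure Ω}
    {R : T → Ω → ℝ} (hRm : ∀ t, Measurable (R t)) (hR : IsGaussianProcess R P)
    (h0 : ∀ t, ∫ ω, R t ω ∂P = 0) {r : T → T → ℝ} (hr : ∀ t s, cov[R t, R s; P] = r t s)
    (c : T → ℝ) : IsGaussianLawWith ((P.map fun ω t ↦ R t ω).map (· + c)) c r := by
  have := hR.isProbabilityMeasure
  have hm : Measurable fun ω t ↦ R t ω + c t := by fun_prop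
  have hmap : (P.map fun ω t ↦ R t ω).map (· + c) = P.map fun ω t ↦ R t ω + c t :=
    Measure.map_map (by fun_prop) (by fun_prop)
  have hint (t : T) : Integrable (R t) P := (hR.hasGaussianLaw_eval t).integrable
  rw [hmap]
  refine ⟨⟨fun I ↦ ⟨?_⟩⟩, fun t ↦ ?_, fun t s ↦ ?_⟩
  · have hI := (hR.hasGaussianLaw I).isGaussian_map
    rw [Measure.map_map (by fun_prop) hm]
    have : P.map ((fun x : T → ℝ ↦ I.restrict fun t ↦ x t) ∘ fun ω t ↦ R t ω + c t) =
        (P.map fun ω ↦ I.restrict fun t ↦ R t ω).map (· + I.restrict c) := by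
      rw [Measure.map_map (by fun_prop) (by fun_prop)]
      rfl
    rw [this]
    infer_instance
  · rw [integral_map hm.aemeasurable (measurable_pi_apply t).aestronglyMeasurable,
      integral_add (hint t) (by fun_prop), h0]
    simp
  · rw [covariance_map_fun (measurable_pi_apply t).aestronglyMeasurable
      (measurable_pi_apply s).aestronglyMeasurable hm.aemeasurable,
      covariance_add_const_left (hint t), covariance_add_const_right (hint s), ← hr]

lemma IsGaussianLawWith.map_domRestrict {T : Type*} {ν : Measure (T → ℝ)} {μ : T → ℝ}
    {r : T → T → ℝ} (h : IsGaussianLawWith ν μ r) (S : Set T) :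
    IsGaussianLawWith (ν.map S.domRestrict) (fun t : S ↦ μ t) (fun t s : S ↦ r t s) := by
  have hm : Measurable (S.domRestrict : (T → ℝ) → S → ℝ) := by
    unfold Set.domRestrict
    fun_prop
  refine ⟨⟨fun I ↦ ⟨?_⟩⟩, fun t ↦ ?_, fun t s ↦ ?_⟩
  · rw [Measure.map_map (by fun_prop) hm]
    exact ((h.gaussian.restrict S).hasGaussianLaw I).isGaussian_map
  · rw [integral_map hm.aemeasurable (measurable_pi_apply t).aestronglyMeasurable]
    exact h.mean t
  · rw [covariance_map_fun (measurable_pi_apply t).aestronglyMeasurable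
      (measurable_pi_apply s).aestronglyMeasurable hm.aemeasurable]
    exact h.covariance t s

/-! ### Uniqueness of conditional laws in countably many coordinates -/

/-- Two regular conditional laws of the same random element have almost surely the same image
under a measurable map into a countably generated space. -/
lemma IsRegularCondLaw.ae_map_eq {Ω E F : Type*} {m mΩ : MeasurableSpace Ω} [MeasurableSpace E]
    [MeasurableSpace F] [MeasurableSpace.CountablyGenerated F] {P : Measure Ω}
    {X : Ω → E} {κ η : @Kernel Ω E m _}
    (hκ : IsRegularCondLaw P m X κ) (hη : IsRegularCondLaw P m X η) {g : E → F}
    (hg : Measurable g) : ∀ᵐ ω ∂P, (κ ω).map g = (η ω).map g := by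
  have := hκ.isMarkov
  have := hη.isMarkov
  set C := generateSetAlgebra (MeasurableSpace.countableGeneratingSet F)
  have hC : C.Countable := countable_generateSetAlgebra
    MeasurableSpace.countable_countableGeneratingSet
  have hgen : ‹MeasurableSpace F› = MeasurableSpace.generateFrom C := by
    rw [generateFrom_generateSetAlgebra_eq, MeasurableSpace.generateFrom_countableGeneratingSet]
  have hCm : ∀ A ∈ C, MeasurableSet A := fun A hA ↦ by
    rw [hgen]
    exact MeasurableSpace.measurableSet_generateFrom hA
  have h : ∀ᵐ ω ∂P, ∀ A ∈ C, (κ ω).real (g ⁻¹' A) = (η ω).real (g ⁻¹' A) := by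
    rw [ae_ball_iff hC]
    exact fun A hA ↦ (hκ.condProb _ (hg (hCm A hA))).trans (hη.condProb _ (hg (hCm A hA))).symm
  filter_upwards [h] with ω hω
  have := Measure.isProbabilityMeasure_map (μ := κ ω) hg.aemeasurable
  have := Measure.isProbabilityMeasure_map (μ := η ω) hg.aemeasurable
  refine ext_of_generate_finite C hgen
    isSetAlgebra_generateSetAlgebra.isSetRing.isSetSemiring.isPiSystem
    (fun A hA ↦ ?_) (by simp)
  rw [Measure.map_apply hg (hCm A hA), Measure.map_apply hg (hCm A hA)]
  exact (measureReal_eq_measureReal_iff).1 (hω A hA)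

/-! ### The prediction law -/

namespace IsBrownianPair

variable {Ω : Type*} [MeasurableSpace Ω] {P : Measure Ω} {W W' : ℝ≥0 → Ω → ℝ}
  {k : ℝ → ℝ → ℝ} {X M : ℝ≥0 → Ω → ℝ} {a b : ℝ} {u : ℝ≥0}

/-- The step functions approximating `k(t,·)` on `(0,t]`, cut off at time `u`, approximate it on
`(0,u]`. -/
lemma exists_isWienerIntegral_volterra (h : IsBrownianPair W W' P)
    (hWm : ∀ t, Measurable (W t)) (hW'm : ∀ t, Measurable (W' t))
    (hk : ∀ t : ℝ≥0, MemLp (k t) 2 (volume.restrict (Set.Ioc (0 : ℝ) t)))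
    (hk0 : ∀ t s : ℝ≥0, t < s → k t s = 0)
    (hX : ∀ t : ℝ≥0, IsWienerIntegral P W (k t) t (X t)) (a b : ℝ) (u t : ℝ≥0) :
    ∃ Y : Ω → ℝ, Measurable[pastSigma (mixedProcess a b W W') u] Y ∧
      IsWienerIntegral P (mixedProcess a b W W') (k t) u Y := by
  obtain ⟨-, φ, hφt, hφ, -⟩ := hX t
  refine h.exists_isWienerIntegral hWm hW'm a b (memLp_volterra hk hk0 t u)
    (φ := fun n ↦ (φ n).truncate u) (fun n i ↦ min_le_right _ _) ?_
  refine tendsto_of_tendsto_of_tendsto_of_le_of_le tendsto_const_nhds hφ (fun _ ↦ zero_le)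
    fun n ↦ ?_
  simp only
  rw [← (φ n).eLpNorm_eval_sub_indicator (hφt n), ← timeMeasure_restrict_Ioc u]
  refine le_trans (le_of_eq (eLpNorm_congr_ae ?_)) (eLpNorm_restrict_le _ _ _ (Set.Ioc (0 : ℝ) u))
  filter_upwards [ae_restrict_mem measurableSet_Ioc] with v hv
  rw [Pi.sub_apply, indicator_Ioc_volterra hk0 t hv.1, StepFun.truncate_eval,
    Set.indicator_of_mem hv]

/-- The law of the residual, translated by the predicted mean, is the conditional law of the
Volterra process. -/
lemma exists_gaussian_condLaw (h : IsBrownianPair W W' P)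
    (hWm : ∀ t, Measurable (W t)) (hW'm : ∀ t, Measurable (W' t))
    (hk : ∀ t : ℝ≥0, MemLp (k t) 2 (volume.restrict (Set.Ioc (0 : ℝ) t)))
    (hk0 : ∀ t s : ℝ≥0, t < s → k t s = 0) (hXm : ∀ t, Measurable (X t))
    (hX : ∀ t : ℝ≥0, IsWienerIntegral P W (k t) t (X t)) (hab : a ^ 2 + b ^ 2 ≠ 0)
    (hMm : ∀ t, Measurable[pastSigma (mixedProcess a b W W') u] (M t))
    (hM : ∀ t : ℝ≥0, IsWienerIntegral P (mixedProcess a b W W') (k t) u (M t)) :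
    ∃ κ : @Kernel Ω (ℝ≥0 → ℝ) (pastSigma (mixedProcess a b W W') u) _,
      IsRegularCondLaw P (pastSigma (mixedProcess a b W W') u) (fun ω t ↦ X t ω) κ ∧
      ∀ ω, IsGaussianLawWith (κ ω) (fun t ↦ a / (a ^ 2 + b ^ 2) * M t ω)
        (predictionCov k a b u) := by
  have := h.isProbabilityMeasure
  have hm : pastSigma (mixedProcess a b W W') u ≤ ‹MeasurableSpace Ω› :=
    iSup₂_le fun v _ ↦ (measurable_mixedProcess hWm hW'm a b v).comap_le
  have hRt (t : ℝ≥0) : Measurable fun ω ↦ X t ω - a / (a ^ 2 + b ^ 2) * M t ω :=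
    (hXm t).sub (((hMm t).mono hm le_rfl).const_mul _)
  have hR : Measurable fun ω (t : ℝ≥0) ↦ X t ω - a / (a ^ 2 + b ^ 2) * M t ω :=
    measurable_pi_lambda _ hRt
  have := Measure.isProbabilityMeasure_map (μ := P) hR.aemeasurable
  have hN : Measurable[pastSigma (mixedProcess a b W W') u]
      fun ω (t : ℝ≥0) ↦ a / (a ^ 2 + b ^ 2) * M t ω :=
    @measurable_pi_lambda Ω ℝ≥0 _ (pastSigma (mixedProcess a b W W') u) _ _ fun t ↦
      (hMm t).const_mul _
  have hres := h.exists_residual_mem_graph hk (fun t ↦ memLp_volterra hk hk0 t u) hX hM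
  refine ⟨@shiftKernel Ω ℝ≥0 (pastSigma (mixedProcess a b W W') u)
    (P.map fun ω t ↦ X t ω - a / (a ^ 2 + b ^ 2) * M t ω) _ _ hN, ?_, fun ω ↦ ?_⟩
  · have hcond := isRegularCondLaw_shiftKernel hm hR
      (h.indep_residual hWm hW'm hk hk0 hX hM hab) hN
    convert hcond using 1
    ext ω t
    simp
  · rw [@shiftKernel_apply Ω ℝ≥0 (pastSigma (mixedProcess a b W W') u)]
    refine isGaussianLawWith_shift hRt (h.isGaussianProcess_of_mem_graph fun t ↦ ⟨_, _, hres t⟩)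
      (fun t ↦ ?_) (h.covariance_residual hk hk0 hX hM) _
    obtain ⟨_, ht⟩ := hres t
    exact h.integral_eq_zero_of_mem_graph ht

end IsBrownianPair

end

theorem theorem2p1 {Ω : Type*} [MeasurableSpace Ω] (P : Measure Ω) [IsProbabilityMeasure P]
    -- two independent Brownian motions
    (W W' : ℝ≥0 → Ω → ℝ)
    (hWm : ∀ t, Measurable (W t)) (hW'm : ∀ t, Measurable (W' t))
    (hW : IsBrownianReal W P) (hW' : IsBrownianReal W' P)
    (hindep : IndepFun (fun ω t ↦ W t ω) (fun ω t ↦ W' t ω) P)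
    -- the Volterra kernel
    (k : ℝ → ℝ → ℝ)
    (hk : ∀ t : ℝ≥0, MemLp (k t) 2 (volume.restrict (Set.Ioc (0 : ℝ) t)))
    (hk0 : ∀ t s : ℝ≥0, t < s → k t s = 0)
    -- the Gaussian Volterra process `X_t = ∫_0^t k(t,s) dW_s`
    (X : ℝ≥0 → Ω → ℝ) (hXm : ∀ t, Measurable (X t))
    (hX : ∀ t : ℝ≥0, IsWienerIntegral P W (k t) t (X t))
    (a b : ℝ) (hab : a ^ 2 + b ^ 2 ≠ 0) (u : ℝ≥0) (hu : 0 < u) :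
    -- the Wiener integrals `∫_0^u k(t,s) dW^{a,b}_s` exist and have versions that are
    -- measurable with respect to the observed σ-algebra
    (∃ M : ℝ≥0 → Ω → ℝ,
      (∀ t, Measurable[pastSigma (mixedProcess a b W W') u] (M t)) ∧
      ∀ t : ℝ≥0, IsWienerIntegral P (mixedProcess a b W W') (k t) u (M t)) ∧
    -- for all such versions, there is a regular conditional law of `X` on `[0,∞)` that is, for
    -- every `ω`, Gaussian with the asserted mean and covariance
    (∀ M : ℝ≥0 → Ω → ℝ,
      (∀ t, Measurable[pastSigma (mixedProcess a b W W') u] (M t)) →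
      (∀ t : ℝ≥0, IsWienerIntegral P (mixedProcess a b W W') (k t) u (M t)) →
      ∃ κ : @Kernel Ω (ℝ≥0 → ℝ) (pastSigma (mixedProcess a b W W') u) _,
        IsRegularCondLaw P (pastSigma (mixedProcess a b W W') u) (fun ω t ↦ X t ω) κ ∧
        ∀ ω, IsGaussianLawWith (κ ω) (fun t ↦ a / (a ^ 2 + b ^ 2) * M t ω)
          (predictionCov k a b u)) ∧
    -- every regular conditional law of `X`, seen at countably many times, is almost surely the
    -- Gaussian law with the asserted mean and covariance
    (∀ M : ℝ≥0 → Ω → ℝ,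
      (∀ t : ℝ≥0, IsWienerIntegral P (mixedProcess a b W W') (k t) u (M t)) →
      ∀ κ : @Kernel Ω (ℝ≥0 → ℝ) (pastSigma (mixedProcess a b W W') u) _,
        IsRegularCondLaw P (pastSigma (mixedProcess a b W W') u) (fun ω t ↦ X t ω) κ →
        ∀ S : Set ℝ≥0, S.Countable →
          ∀ᵐ ω ∂P, IsGaussianLawWith ((κ ω).map S.domRestrict)
            (fun t : S ↦ a / (a ^ 2 + b ^ 2) * M t ω)
            (fun t s : S ↦ predictionCov k a b u t s)) := by
  have h : IsBrownianPair W W' P := ⟨hW.toIsPreBrownianReal, hW'.toIsPreBrownianReal, hindep⟩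
  choose M₀ hM₀m hM₀ using h.exists_isWienerIntegral_volterra hWm hW'm hk hk0 hX a b u
  refine ⟨⟨M₀, hM₀m, hM₀⟩, fun M hMm hM ↦
    h.exists_gaussian_condLaw hWm hW'm hk hk0 hXm hX hab hMm hM, fun M hM κ hκ S hS ↦ ?_⟩
  obtain ⟨κ₀, hκ₀, hG⟩ := h.exists_gaussian_condLaw hWm hW'm hk hk0 hXm hX hab hM₀m hM₀
  -- The versions `M` need not be measurable with respect to the past, so they are compared with `M₀`.
  have hMeq (t : ℝ≥0) : M t =ᵐ[P] M₀ t := by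
    have hkt := memLp_volterra hk hk0 t u
    obtain ⟨hL, hmem⟩ := h.exists_mem_graph_of_isWienerIntegral hkt (hM t)
    obtain ⟨hL₀, hmem₀⟩ := h.exists_mem_graph_of_isWienerIntegral hkt (hM₀ t)
    exact (MemLp.toLp_eq_toLp_iff hL hL₀).1 (h.eq_of_mem_graph hmem hmem₀)
  have := hS.to_subtype
  have hres : Measurable (S.domRestrict : (ℝ≥0 → ℝ) → S → ℝ) :=
    measurable_pi_lambda _ fun t ↦ measurable_pi_apply (t : ℝ≥0)
  filter_upwards [hκ.ae_map_eq hκ₀ hres, ae_all_iff.2 fun t : S ↦ hMeq t] with ω h1 h2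
  rw [h1]
  simp only [h2]
  exact (hG ω).map_domRestrict S
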